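/- Let $\alpha_\sigma>0$ and let $G_\sigma$ be a probability measure on $(0,\infty)$ for which there are positive constants $a_1,a_2,a_3,b_1,b_2,b_3,b_4$ such that, for all $x\ge 1$, $$G_\sigma(\sigma>x)\lesssim e^{-a_1x^{b_1}},\qquad G_\sigma(\sigma\le 1/x)\lesssim e^{-a_2x^{b_2}},\qquad G_\sigma\big(x^{-1}\le\sigma\le x^{-1}(1+t)\big)\gtrsim x^{b_3}t^{b_4}e^{-a_3x}\quad\text{for all } t\in(0,1).$$ Let $\Pi_\sigma$ be a Dirichlet process with base measure $\alpha_\sigma G_\sigma$, that is, a law on the space of probability measures $P_\sigma$ on $(0,\infty)$ such that for every finite Borel partition $A_1,\dots,A_k$ of $(0,\infty)$ the vector $(P_\sigma(A_1),\dots,P_\sigma(A_k))$ has the Dirichlet distribution with parameters $\alpha_\sigma G_\sigma(A_1),\dots,\alpha_\sigma G_\sigma(A_k)$ (a coordinate with parameter $0$ is almost surely $0$). Then: 1. for every $a_4\in(0,a_1)$ and all $x$ large enough, $$\Pi_\sigma\big(P_\sigma: P_\sigma(\sigma>x)\ge e^{-a_1x^{b_1}/2}\big)\lesssim e^{-a_4x^{b_1}};$$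 2. for every $a_5\in(0,a_2)$ and all $x$ large enough, $$\Pi_\sigma\big(P_\sigma: P_\sigma(\sigma<1/x)\ge e^{-a_2x^{b_2}/2}\big)\lesssim e^{-a_5x^{b_2}};$$ 3. for every real $r\ge1$ there is a constant $a_6>0$, which may depend on $r$, such that for all integers $J$ large enough $$\Pi_\sigma\Big(\bigcap_{j=0}^{J}\big\{P_\sigma: P_\sigma[2^{-j},2^{-j}(1+2^{-Jr})]\ge 2^{-J}\big\}\Big)\gtrsim e^{-a_6 2^J}.$$ Here $\lesssim$ and $\gtrsim$ are inequalities up to a positive multiplicative constant that does not depend on $x$, $t$ or $J$ (but may depend on everything else, in particular on $a_4$, $a_5$, $r$). -/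

import Mathlib

open MeasureTheory ProbabilityTheory

/-- The law of a `Gamma(a, 1)` random variable for `a > 0`, with the usual convention that it is the
point mass at `0` when the shape parameter vanishes. -/
noncomputable def gammaLaw (a : ℝ) : Measure ℝ :=
  if 0 < a then gammaMeasure a 1 else Measure.dirac 0

instance gammaLaw_isProbabilityMeasure (a : ℝ) : IsProbabilityMeasure (gammaLaw a) := by
  unfold gammaLaw
  split_ifs with h
  · exact isProbabilityMeasure_gammaMeasure h one_pos
  · infer_instance

/-- The Dirichlet distribution with parameters `a i ≥ 0`, not all zero: the law of
`(Z i / ∑ j, Z j)_i` where the `Z i` are independent with laws `Gamma(a i, 1)`. Coordinates whose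
parameter is zero are almost surely zero. -/
noncomputable def dirichletLaw {k : ℕ} (a : Fin k → ℝ) : Measure (Fin k → ℝ) :=
  (Measure.pi fun i => gammaLaw (a i)).map fun z i => z i / ∑ j, z j

/-- `D`, a law on the space of probability measures on `Ω`, is a Dirichlet process with base measure
`α`: for every finite measurable partition `A` of `Ω`, the vector `(P (A i))_i` with `P ∼ D` is
Dirichlet distributed with parameters `α (A i)`. -/
def IsDirichletProcess {Ω : Type*} [MeasurableSpace Ω]
    (D : Measure (ProbabilityMeasure Ω)) (α : Measure Ω) : Prop :=
  ∀ (k : ℕ) (A : Fin k → Set Ω), (∀ i, MeasurableSet (A i)) →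
    (∀ i j, i ≠ j → Disjoint (A i) (A j)) → (⋃ i, A i) = Set.univ →
    D.map (fun (P : ProbabilityMeasure Ω) i => (P : Measure Ω).real (A i)) = dirichletLaw fun i => α.real (A i)

/-- The space of scales `(0, ∞)`. -/
abbrev Scale : Type := Set.Ioi (0 : ℝ)

/-- `G(σ > x) ≲ exp(-a x ^ b)` for `x ≥ 1`. -/
def ScaleUpperTail (G : Measure Scale) (a b : ℝ) : Prop :=
  ∃ C : ℝ, 0 < C ∧ ∀ x : ℝ, 1 ≤ x →
    G.real {σ : Scale | x < (σ : ℝ)} ≤ C * Real.exp (-(a * x ^ b))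

/-- `G(σ ≤ 1 / x) ≲ exp(-a x ^ b)` for `x ≥ 1`. -/
def ScaleLowerTail (G : Measure Scale) (a b : ℝ) : Prop :=
  ∃ C : ℝ, 0 < C ∧ ∀ x : ℝ, 1 ≤ x →
    G.real {σ : Scale | (σ : ℝ) ≤ 1 / x} ≤ C * Real.exp (-(a * x ^ b))

/-- `G(1 / x ≤ σ ≤ (1 + t) / x) ≳ x ^ b t ^ b' exp(-a x)` for `x ≥ 1` and `0 < t < 1`. -/
def ScaleSmallBall (G : Measure Scale) (a b b' : ℝ) : Prop :=
  ∃ c : ℝ, 0 < c ∧ ∀ x : ℝ, 1 ≤ x → ∀ t : ℝ, 0 < t → t < 1 →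
    c * (x ^ b * t ^ b' * Real.exp (-(a * x))) ≤
      G.real {σ : Scale | x⁻¹ ≤ (σ : ℝ) ∧ (σ : ℝ) ≤ x⁻¹ * (1 + t)}

/-- `D(P : P(σ > x) ≥ exp(-a x ^ b / 2)) ≲ exp(-a' x ^ b)` for all large `x`. -/
def HybridUpperTail (D : Measure (ProbabilityMeasure Scale)) (a b a' : ℝ) : Prop :=
  ∃ C : ℝ, 0 < C ∧ ∃ x₀ : ℝ, 0 < x₀ ∧ ∀ x : ℝ, x₀ ≤ x →
    D.real {P | Real.exp (-(a * x ^ b / 2)) ≤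
      (P : Measure Scale).real {σ : Scale | x < (σ : ℝ)}} ≤ C * Real.exp (-(a' * x ^ b))

/-- `D(P : P(σ < 1 / x) ≥ exp(-a x ^ b / 2)) ≲ exp(-a' x ^ b)` for all large `x`. -/
def HybridLowerTail (D : Measure (ProbabilityMeasure Scale)) (a b a' : ℝ) : Prop :=
  ∃ C : ℝ, 0 < C ∧ ∃ x₀ : ℝ, 0 < x₀ ∧ ∀ x : ℝ, x₀ ≤ x →
    D.real {P | Real.exp (-(a * x ^ b / 2)) ≤
      (P : Measure Scale).real {σ : Scale | (σ : ℝ) < 1 / x}} ≤ C * Real.exp (-(a' * x ^ b))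

/-- `D(⋂_{0 ≤ j ≤ J} {P : P[2^{-j}, 2^{-j}(1 + 2^{-Jr})] ≥ 2^{-J}}) ≳ exp(-a J ^ b 2 ^ J)` for all
large integers `J`. -/
def HybridSmallBall (D : Measure (ProbabilityMeasure Scale)) (r a b : ℝ) : Prop :=
  ∃ c : ℝ, 0 < c ∧ ∃ J₀ : ℕ, ∀ J : ℕ, J₀ ≤ J →
    c * Real.exp (-(a * (J : ℝ) ^ b * 2 ^ J)) ≤
      D.real (⋂ j ∈ Finset.range (J + 1), {P : ProbabilityMeasure Scale |
        ((2 : ℝ) ^ J)⁻¹ ≤ (P : Measure Scale).real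
          {σ : Scale | ((2 : ℝ) ^ j)⁻¹ ≤ (σ : ℝ) ∧
            (σ : ℝ) ≤ ((2 : ℝ) ^ j)⁻¹ * (1 + (2 : ℝ) ^ (-((J : ℝ) * r)))}})

/-! Everything reduces to independent Gamma variables, normalised by their sum, and to the fact that
as the shape `a` tends to `0` both `E Z ^ s` and `P(1 ≤ Z ≤ 2)` are of exact order `a`, because `1 /
Γ(a) = a / Γ(a + 1)`.

Tails: for the partition `{A, Aᶜ}`, `P(A) = Z₁ / (Z₁ + Z₂) ≤ Z₁ / Z₂`, so Markov's inequality with a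
small power `s` gives `D(P(A) ≥ u) ≲ G(A) u ^ (-s)` (`exists_measureReal_le`). With `u = exp(-a x ^
b / 2)`, the loss `u ^ (-s)` is absorbed in the gap between the two exponents.

Small balls: if the Gamma variables of `n` disjoint sets lie in `[1, 2]` and that of the remaining
cell is at most `N`, every set gets mass at least `1 / (N + 2n)`. This has probability at least `1/2
∏ c G(I i)` (`exists_le_measureReal`). For the dyadic intervals the exponents add up to order `J ^ 2
+ ∑ 2 ^ j`, hence to order `2 ^ J`. -/

/-! ### Gamma laws, uniformly in the shape parameter. -/

theorem gammaLaw_of_pos {a : ℝ} (ha : 0 < a) : gammaLaw a = gammaMeasure a 1 := if_pos ha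

theorem gammaLaw_zero : gammaLaw 0 = Measure.dirac 0 := if_neg (lt_irrefl _)

theorem measurable_gammaPDF (a r : ℝ) : Measurable (gammaPDF a r) :=
  (measurable_gammaPDFReal a r).ennreal_ofReal

/-- Multiplying the `Gamma(a, 1)` density by `z ^ s` gives a constant multiple of the `Gamma(a + s,
1)` density. -/
theorem lintegral_rpow_gammaMeasure {a s : ℝ} (ha : 0 < a) (has : 0 < a + s) :
    ∫⁻ z, ENNReal.ofReal (z ^ s) ∂gammaMeasure a 1 =
      ENNReal.ofReal (Real.Gamma (a + s) / Real.Gamma a) := by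
  have h1 : Measurable fun z : ℝ => ENNReal.ofReal (z ^ s) :=
    (measurable_id.pow_const s).ennreal_ofReal
  rw [gammaMeasure, lintegral_withDensity_eq_lintegral_mul _ (measurable_gammaPDF a 1) h1]
  have key : ∀ᵐ z : ℝ, (gammaPDF a 1 * fun z => ENNReal.ofReal (z ^ s)) z =
      ENNReal.ofReal (Real.Gamma (a + s) / Real.Gamma a) * gammaPDF (a + s) 1 z := by
    filter_upwards [Measure.ae_ne volume (0 : ℝ)] with z hz
    rcases lt_or_gt_of_ne hz with h | h
    · simp [gammaPDF_of_neg h]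
    · have g1 := Real.Gamma_pos_of_pos ha
      have g2 := Real.Gamma_pos_of_pos has
      simp only [Pi.mul_apply, gammaPDF_of_nonneg h.le]
      rw [← ENNReal.ofReal_mul (by positivity), ← ENNReal.ofReal_mul (by positivity)]
      congr 1
      have : z ^ (a + s - 1) = z ^ (a - 1) * z ^ s := by
        rw [← Real.rpow_add h]; ring_nf
      rw [this]
      simp only [Real.one_rpow]
      field_simp
  rw [lintegral_congr_ae key, lintegral_const_mul _ (measurable_gammaPDF _ _),
    lintegral_gammaPDF_eq_one has one_pos, mul_one]

theorem continuousOn_Gamma_Ioi : ContinuousOn Real.Gamma (Set.Ioi 0) :=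
  Real.differentiableOn_Gamma_Ioi.continuousOn

/-- Positive moments of the Gamma law vanish linearly in the shape parameter. -/
theorem exists_lintegral_rpow_gammaLaw_le {s : ℝ} (hs : 0 < s) (M : ℝ) :
    ∃ C : ℝ, 0 < C ∧ ∀ a, 0 ≤ a → a ≤ M →
      ∫⁻ z, ENNReal.ofReal (z ^ s) ∂gammaLaw a ≤ ENNReal.ofReal (C * a) := by
  -- With `Γ(a + 1)` in place of `Γ(a)` the quotient stays continuous at `a = 0`; the missing factor
  -- `a` is the linear decay wanted.
  have hc : ContinuousOn (fun a : ℝ => Real.Gamma (a + s) / Real.Gamma (a + 1)) (Set.Icc 0 M) := by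
    refine ContinuousOn.div ?_ ?_ fun a ha => (Real.Gamma_pos_of_pos (by linarith [ha.1])).ne'
    · exact continuousOn_Gamma_Ioi.comp (by fun_prop) fun a ha => by
        simp only [Set.mem_Ioi]; linarith [ha.1]
    · exact continuousOn_Gamma_Ioi.comp (by fun_prop) fun a ha => by
        simp only [Set.mem_Ioi]; linarith [ha.1]
  obtain ⟨C, hC⟩ := (isCompact_Icc.image_of_continuousOn hc).bddAbove
  refine ⟨max C 1, by positivity, fun a ha haM => ?_⟩
  rcases ha.eq_or_lt with rfl | ha'
  · simp [gammaLaw_zero, Real.zero_rpow hs.ne']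
  · rw [gammaLaw_of_pos ha', lintegral_rpow_gammaMeasure ha' (by linarith)]
    apply ENNReal.ofReal_le_ofReal
    have h1 : Real.Gamma (a + s) / Real.Gamma (a + 1) ≤ C := hC ⟨a, ⟨ha, haM⟩, rfl⟩
    rw [Real.Gamma_add_one ha'.ne'] at h1
    have g1 := Real.Gamma_pos_of_pos ha'
    calc Real.Gamma (a + s) / Real.Gamma a
        = Real.Gamma (a + s) / (a * Real.Gamma a) * a := by field_simp
      _ ≤ max C 1 * a := by gcongr; exact h1.trans (le_max_left _ _)

/-- Small negative moments of the Gamma law are locally bounded in the shape parameter. -/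
theorem exists_lintegral_rpow_neg_gammaLaw_le {s m : ℝ} (hm : 0 < m) (hs : s < m) (M : ℝ) :
    ∃ C : ℝ, 0 < C ∧ ∀ b, m ≤ b → b ≤ M →
      ∫⁻ z, ENNReal.ofReal (z ^ (-s)) ∂gammaLaw b ≤ ENNReal.ofReal C := by
  have hc : ContinuousOn (fun a : ℝ => Real.Gamma (a + -s) / Real.Gamma a) (Set.Icc m M) := by
    refine ContinuousOn.div ?_ ?_ fun a ha => (Real.Gamma_pos_of_pos (by linarith [ha.1])).ne'
    · exact continuousOn_Gamma_Ioi.comp (by fun_prop) fun a ha => by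
        simp only [Set.mem_Ioi]; linarith [ha.1]
    · exact continuousOn_Gamma_Ioi.mono fun a ha => lt_of_lt_of_le hm ha.1
  obtain ⟨C, hC⟩ := (isCompact_Icc.image_of_continuousOn hc).bddAbove
  refine ⟨max C 1, by positivity, fun b hb hbM => ?_⟩
  have hb' : 0 < b := hm.trans_le hb
  rw [gammaLaw_of_pos hb', lintegral_rpow_gammaMeasure hb' (by linarith)]
  exact ENNReal.ofReal_le_ofReal ((hC ⟨b, ⟨hb, hbM⟩, rfl⟩).trans (le_max_left _ _))

theorem ae_gammaMeasure_pos (a : ℝ) : ∀ᵐ z ∂gammaMeasure a 1, 0 < z := by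
  have h : (volume : Measure ℝ).withDensity (gammaPDF a 1) (Set.Iic 0) = 0 := by
    rw [withDensity_apply _ measurableSet_Iic, setLIntegral_congr Iio_ae_eq_Iic.symm]
    exact lintegral_gammaPDF_of_nonpos le_rfl
  rw [ae_iff]
  simp only [not_lt]
  exact h

theorem ae_gammaLaw_nonneg (a : ℝ) : ∀ᵐ z ∂gammaLaw a, 0 ≤ z := by
  unfold gammaLaw
  split_ifs
  · filter_upwards [ae_gammaMeasure_pos a] with z hz using hz.le
  · rw [ae_dirac_iff measurableSet_Ici]

/-- On `[1, 2]` the density is at least `exp(-2) / (2 Γ(a))`, and `1 / Γ(a) = a / Γ(a + 1)` is at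
least linear in `a`. -/
theorem exists_le_gammaLaw_Icc {M : ℝ} (hM : 0 < M) :
    ∃ c : ℝ, 0 < c ∧ ∀ a, 0 ≤ a → a ≤ M →
      ENNReal.ofReal (c * a) ≤ gammaLaw a (Set.Icc 1 2) := by
  have hc : ContinuousOn (fun a : ℝ => Real.Gamma (a + 1)) (Set.Icc 0 M) :=
    continuousOn_Gamma_Ioi.comp (by fun_prop) fun a ha => by
        simp only [Set.mem_Ioi]; linarith [ha.1]
  obtain ⟨C, hC⟩ := (isCompact_Icc.image_of_continuousOn hc).bddAbove
  have hCpos : 0 < C := (Real.Gamma_pos_of_pos (by linarith)).trans_le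
    (hC ⟨M, ⟨hM.le, le_rfl⟩, rfl⟩)
  refine ⟨1 / C * (1 / 2) * Real.exp (-2), by positivity, fun a ha haM => ?_⟩
  rcases ha.eq_or_lt with rfl | ha'
  · simp
  rw [gammaLaw_of_pos ha', gammaMeasure, withDensity_apply _ measurableSet_Icc]
  have hG : a * Real.Gamma a ≤ C := by
    rw [← Real.Gamma_add_one ha'.ne']; exact hC ⟨a, ⟨ha, haM⟩, rfl⟩
  have g1 := Real.Gamma_pos_of_pos ha'
  calc ENNReal.ofReal (1 / C * (1 / 2) * Real.exp (-2) * a)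
      = ∫⁻ _ in Set.Icc (1 : ℝ) 2, ENNReal.ofReal (1 / C * (1 / 2) * Real.exp (-2) * a) := by
        rw [setLIntegral_const, Real.volume_Icc]; norm_num
    _ ≤ _ := by
        refine setLIntegral_mono' measurableSet_Icc fun z hz => ?_
        have hz0 : 0 < z := by linarith [hz.1]
        rw [gammaPDF_of_nonneg hz0.le]
        apply ENNReal.ofReal_le_ofReal
        have e1 : 1 / 2 ≤ z ^ (a - 1) := by
          calc 1 / 2 ≤ z⁻¹ := by rw [one_div]; exact inv_anti₀ hz0 hz.2
            _ = z ^ (-1 : ℝ) := (Real.rpow_neg_one z).symm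
            _ ≤ z ^ (a - 1) := Real.rpow_le_rpow_of_exponent_le hz.1 (by linarith)
        have e2 : Real.exp (-2) ≤ Real.exp (-(1 * z)) := Real.exp_le_exp.2 (by linarith [hz.2])
        have e3 : 1 / C * a ≤ 1 / Real.Gamma a := by
          rw [one_div_mul_eq_div, div_le_div_iff₀ hCpos g1]; linarith
        rw [Real.one_rpow]
        calc 1 / C * (1 / 2) * Real.exp (-2) * a = 1 / C * a * (1 / 2) * Real.exp (-2) := by ring
          _ ≤ _ := by gcongr

/-- Markov's inequality with the first moment, which is bounded uniformly in the shape. -/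
theorem exists_half_le_gammaLaw_Iic (M : ℝ) :
    ∃ N : ℝ, 0 < N ∧ ∀ a, 0 ≤ a → a ≤ M → ENNReal.ofReal (1 / 2) ≤ gammaLaw a (Set.Iic N) := by
  obtain ⟨C, hC, h⟩ := exists_lintegral_rpow_gammaLaw_le one_pos M
  refine ⟨2 * C * |M| + 1, by positivity, fun a ha haM => ?_⟩
  set N := 2 * C * |M| + 1 with hN
  have hNpos : 0 < N := by positivity
  have h1 : gammaLaw a (Set.Iic N)ᶜ ≤ ENNReal.ofReal (1 / 2) := by
    calc gammaLaw a (Set.Iic N)ᶜ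
        ≤ gammaLaw a {z | ENNReal.ofReal N ≤ ENNReal.ofReal (z ^ (1 : ℝ))} := by
          refine measure_mono fun z hz => ?_
          simp only [Set.mem_compl_iff, Set.mem_Iic, not_le] at hz
          simpa using ENNReal.ofReal_le_ofReal hz.le
      _ ≤ (∫⁻ z, ENNReal.ofReal (z ^ (1 : ℝ)) ∂gammaLaw a) / ENNReal.ofReal N :=
          meas_ge_le_lintegral_div (by fun_prop) (by simpa using hNpos) (by simp)
      _ ≤ ENNReal.ofReal (C * a) / ENNReal.ofReal N := by gcongr; exact h a ha haM
      _ = ENNReal.ofReal (C * a / N) := (ENNReal.ofReal_div_of_pos hNpos).symm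
      _ ≤ ENNReal.ofReal (1 / 2) := by
          apply ENNReal.ofReal_le_ofReal
          rw [div_le_div_iff₀ hNpos two_pos]
          have : C * a ≤ C * |M| := by gcongr; exact haM.trans (le_abs_self M)
          linarith
  have h2 := prob_add_prob_compl (μ := gammaLaw a) (measurableSet_Iic (a := N))
  have h3 : (1 : ENNReal) = ENNReal.ofReal (1 / 2) + ENNReal.ofReal (1 / 2) := by
    rw [← ENNReal.ofReal_add (by norm_num) (by norm_num)]; norm_num
  by_contra! hcon
  have := ENNReal.add_lt_add_of_lt_of_le (by exact (h1.trans_lt (by simp)).ne) hcon h1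
  rw [h2, ← h3] at this
  exact lt_irrefl _ this

/-! ### Masses of sets under a Dirichlet process. -/

instance dirichletLaw_isProbabilityMeasure {k : ℕ} (a : Fin k → ℝ) :
    IsProbabilityMeasure (dirichletLaw a) :=
  Measure.isProbabilityMeasure_map (by fun_prop)

theorem IsDirichletProcess.measure_eq {Ω : Type*} [MeasurableSpace Ω]
    {D : Measure (ProbabilityMeasure Ω)} {α : Measure Ω} (hD : IsDirichletProcess D α)
    {k : ℕ} {A : Fin k → Set Ω} (hA : ∀ i, MeasurableSet (A i))
    (hdisj : ∀ i j, i ≠ j → Disjoint (A i) (A j)) (hU : (⋃ i, A i) = Set.univ)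
    {B : Set (Fin k → ℝ)} (hB : MeasurableSet B) :
    D {P | (fun i => (P : Measure Ω).real (A i)) ∈ B} =
      Measure.pi (fun i => gammaLaw (α.real (A i))) {z | (fun i => z i / ∑ j, z j) ∈ B} := by
  have h := hD k A hA hdisj hU
  -- A map that is not a.e. measurable would push `D` to the zero measure, whereas the image here is
  -- a probability measure.
  have hm : AEMeasurable (fun (P : ProbabilityMeasure Ω) i => (P : Measure Ω).real (A i)) D :=
    AEMeasurable.of_map_ne_zero (by rw [h]; exact IsProbabilityMeasure.ne_zero _)
  have h2 := congrArg (fun μ => μ B) h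
  simp only [dirichletLaw] at h2
  rw [Measure.map_apply_of_aemeasurable hm hB, Measure.map_apply (by fun_prop) hB] at h2
  exact h2

/-- A tail bound for the ratio of a Gamma variable to the sum of two independent ones. -/
theorem prod_gammaLaw_ratio_le {a b s u : ℝ} (hb : 0 < b) (hs : 0 < s) (hu : 0 < u) :
    (gammaLaw a).prod (gammaLaw b) {z | u ≤ z.1 / (z.1 + z.2)} ≤
      ENNReal.ofReal (u ^ (-s)) * ((∫⁻ z, ENNReal.ofReal (z ^ s) ∂gammaLaw a) *
        ∫⁻ z, ENNReal.ofReal (z ^ (-s)) ∂gammaLaw b) := by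
  rw [← lintegral_prod_mul (by fun_prop) (by fun_prop),
    ← lintegral_const_mul _ (by fun_prop)]
  have hS : MeasurableSet {z : ℝ × ℝ | u ≤ z.1 / (z.1 + z.2)} :=
    measurableSet_le measurable_const (by fun_prop)
  rw [← lintegral_indicator_one hS]
  have h1 : ∀ᵐ z ∂(gammaLaw a).prod (gammaLaw b), 0 ≤ z.1 :=
    Measure.quasiMeasurePreserving_fst.ae (ae_gammaLaw_nonneg a)
  have h2 : ∀ᵐ z ∂(gammaLaw a).prod (gammaLaw b), 0 < z.2 :=
    Measure.quasiMeasurePreserving_snd.ae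
      (by rw [gammaLaw_of_pos hb]; exact ae_gammaMeasure_pos b)
  apply lintegral_mono_ae
  filter_upwards [h1, h2] with z hz1 hz2
  by_cases hz : z ∈ {z : ℝ × ℝ | u ≤ z.1 / (z.1 + z.2)}
  · rw [Set.indicator_of_mem hz, ← ENNReal.ofReal_mul (by positivity),
      ← ENNReal.ofReal_mul (by positivity), Pi.one_apply, ← ENNReal.ofReal_one]
    apply ENNReal.ofReal_le_ofReal
    have h3 : u ≤ z.1 / z.2 := (show u ≤ z.1 / (z.1 + z.2) from hz).trans (by gcongr; linarith)
    rw [Real.rpow_neg hu.le, Real.rpow_neg hz2.le]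
    have h4 : u ^ s ≤ (z.1 / z.2) ^ s := Real.rpow_le_rpow hu.le h3 hs.le
    rw [Real.div_rpow hz1 hz2.le, div_eq_mul_inv] at h4
    calc (1 : ℝ) = (u ^ s)⁻¹ * u ^ s := (inv_mul_cancel₀ (Real.rpow_pos_of_pos hu s).ne').symm
      _ ≤ _ := by gcongr
  · rw [Set.indicator_of_notMem hz]; exact zero_le

theorem real_ofReal_smul {Ω : Type*} [MeasurableSpace Ω] {α : ℝ} (hα : 0 ≤ α) (G : Measure Ω)
    (A : Set Ω) : (ENNReal.ofReal α • G).real A = α * G.real A := by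
  simp [Measure.real, hα]

/-- A set of small base mass rarely receives more than `u` under a Dirichlet process. -/
theorem IsDirichletProcess.exists_measureReal_le {Ω : Type*} [MeasurableSpace Ω]
    {D : Measure (ProbabilityMeasure Ω)} [IsProbabilityMeasure D] {α : ℝ} (hα : 0 < α)
    {G : Measure Ω} [IsProbabilityMeasure G]
    (hD : IsDirichletProcess D (ENNReal.ofReal α • G)) {s : ℝ} (hs : 0 < s) (hsα : s < α / 2) :
    -- `G(A) ≤ 1/2` keeps the shape of the complement above `α / 2 > s`, so its moment of order `-s`
    -- is finite and uniformly bounded.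
    ∃ C : ℝ, 0 < C ∧ ∀ A : Set Ω, MeasurableSet A → G.real A ≤ 1 / 2 → ∀ u : ℝ, 0 < u →
      D.real {P | u ≤ (P : Measure Ω).real A} ≤ C * (G.real A * u ^ (-s)) := by
  obtain ⟨C₁, hC₁, h₁⟩ := exists_lintegral_rpow_gammaLaw_le hs α
  obtain ⟨C₂, hC₂, h₂⟩ := exists_lintegral_rpow_neg_gammaLaw_le (half_pos hα) hsα α
  refine ⟨C₁ * α * C₂, by positivity, fun A hA hA2 u hu => ?_⟩
  have hp0 : 0 ≤ G.real A := measureReal_nonneg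
  have hc : G.real Aᶜ = 1 - G.real A := probReal_compl_eq_one_sub hA
  have h := hD.measure_eq (A := ![A, Aᶜ]) (by intro i; fin_cases i <;> simp [hA])
    (by
      intro i j hij
      fin_cases i <;> fin_cases j <;>
        simp_all [disjoint_compl_right, disjoint_compl_left])
    (by ext x; simp [Fin.exists_fin_two, em]) (B := {v | u ≤ v 0})
    (measurableSet_le measurable_const (measurable_pi_apply 0))
  have mp := measurePreserving_piFinTwo
    (fun i : Fin 2 => gammaLaw ((ENNReal.ofReal α • G).real ((![A, Aᶜ] : Fin 2 → Set Ω) i)))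
  have h3 := mp.measure_preimage (s := {z : ℝ × ℝ | u ≤ z.1 / (z.1 + z.2)})
    (measurableSet_le measurable_const (by fun_prop)).nullMeasurableSet
  have h4 : D {P | u ≤ (P : Measure Ω).real A} ≤
      ENNReal.ofReal (C₁ * α * C₂ * (G.real A * u ^ (-s))) := by
    calc D {P | u ≤ (P : Measure Ω).real A} = _ := h
      _ = _ := by
        rw [← h3]
        congr 1
        ext z
        simp [Fin.sum_univ_two, MeasurableEquiv.piFinTwo]
      _ ≤ _ := prod_gammaLaw_ratio_le (by
          simp only [Matrix.cons_val_one, Matrix.cons_val_zero, real_ofReal_smul hα.le, hc]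
          nlinarith) hs hu
      _ ≤ ENNReal.ofReal (u ^ (-s)) * (ENNReal.ofReal (C₁ * (α * G.real A)) *
          ENNReal.ofReal C₂) := by
        simp only [Matrix.cons_val_one, Matrix.cons_val_zero, real_ofReal_smul hα.le, hc]
        gcongr
        · exact h₁ _ (by positivity) (by nlinarith)
        · exact h₂ _ (by nlinarith) (by nlinarith)
      _ = _ := by
        rw [← ENNReal.ofReal_mul (by positivity), ← ENNReal.ofReal_mul (by positivity)]
        congr 1; ring
  exact ENNReal.toReal_le_of_le_ofReal (by positivity) h4

/-- A lower bound for the probability that a Dirichlet process charges each of finitely many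
disjoint sets. -/
theorem IsDirichletProcess.exists_le_measureReal {Ω : Type*} [MeasurableSpace Ω]
    {D : Measure (ProbabilityMeasure Ω)} [IsProbabilityMeasure D] {α : ℝ} (hα : 0 < α)
    {G : Measure Ω} [IsProbabilityMeasure G]
    (hD : IsDirichletProcess D (ENNReal.ofReal α • G)) :
    ∃ c N : ℝ, 0 < c ∧ 0 < N ∧ ∀ (n : ℕ) (I : Fin n → Set Ω), (∀ i, MeasurableSet (I i)) →
      (∀ i j, i ≠ j → Disjoint (I i) (I j)) → ∀ u : ℝ, 0 < u → u * (N + 2 * n) ≤ 1 →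
      1 / 2 * ∏ i, (c * G.real (I i)) ≤ D.real {P | ∀ i, u ≤ (P : Measure Ω).real (I i)} := by
  obtain ⟨c, hc, h₁⟩ := exists_le_gammaLaw_Icc hα
  obtain ⟨N, hN, h₂⟩ := exists_half_le_gammaLaw_Iic α
  refine ⟨c * α, N, by positivity, hN, fun n I hI hdisj u hu huN => ?_⟩
  have hp (A : Set Ω) : 0 ≤ G.real A ∧ G.real A ≤ 1 := ⟨measureReal_nonneg, measureReal_le_one⟩
  -- Cell `0` is the complement of the union, completing the sets to a partition.
  set A : Fin (n + 1) → Set Ω := Fin.cons (⋃ i, I i)ᶜ I with hAdef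
  have h := hD.measure_eq (A := A)
    (by
      intro i
      refine Fin.cases ?_ (fun j => ?_) i
      · exact (MeasurableSet.iUnion hI).compl
      · exact hI j)
    (by
      have h0 (j : Fin n) : Disjoint (⋃ i, I i)ᶜ (I j) :=
        (disjoint_compl_left (a := ⋃ i, I i)).mono_right (Set.subset_iUnion I j)
      intro i
      refine Fin.cases ?_ (fun i => ?_) i <;> intro j <;> refine Fin.cases ?_ (fun j => ?_) j
      · simp
      · intro _; exact h0 j
      · intro _; exact (h0 i).symm
      · intro hij; exact hdisj i j (fun e => hij (by rw [e])))
    (by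
      ext x
      simp only [A, Set.mem_iUnion, Fin.exists_fin_succ, Fin.cons_zero, Fin.cons_succ,
        Set.mem_compl_iff, Set.mem_univ, iff_true]
      exact (em _).symm)
    (B := {v | ∀ i : Fin n, u ≤ v i.succ})
    (by
      simp only [Set.ofPred_forall]
      exact MeasurableSet.iInter fun i => measurableSet_le measurable_const (measurable_pi_apply _))
  have h4 : ENNReal.ofReal (1 / 2 * ∏ i, (c * α * G.real (I i))) ≤
      D {P | ∀ i, u ≤ (P : Measure Ω).real (I i)} := by
    refine le_trans ?_ (h.symm.le.trans_eq (by simp [A]))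
    calc ENNReal.ofReal (1 / 2 * ∏ i, (c * α * G.real (I i)))
        = ENNReal.ofReal (1 / 2) * ∏ i, ENNReal.ofReal (c * (α * G.real (I i))) := by
          rw [ENNReal.ofReal_mul (by norm_num), ENNReal.ofReal_prod_of_nonneg fun i _ => by
            have := (hp (I i)).1; positivity]
          simp only [mul_assoc]
      _ ≤ gammaLaw ((ENNReal.ofReal α • G).real (A 0)) (Set.Icc 0 N) *
          ∏ i : Fin n, gammaLaw ((ENNReal.ofReal α • G).real (A i.succ)) (Set.Icc 1 2) := by
          simp only [real_ofReal_smul hα.le]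
          have hb (B : Set Ω) : 0 ≤ α * G.real B ∧ α * G.real B ≤ α :=
            ⟨mul_nonneg hα.le (hp B).1, mul_le_of_le_one_right hα.le (hp B).2⟩
          gcongr with i
          · refine (h₂ _ (hb _).1 (hb _).2).trans (measure_mono_ae ?_)
            filter_upwards [ae_gammaLaw_nonneg (α * G.real (A 0))] with z hz hz' using ⟨hz, hz'⟩
          · exact h₁ _ (hb _).1 (hb _).2
      _ = Measure.pi (fun i => gammaLaw ((ENNReal.ofReal α • G).real (A i)))
            (Set.univ.pi (Fin.cons (Set.Icc 0 N) fun _ => Set.Icc 1 2)) := by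
          rw [Measure.pi_pi, Fin.prod_univ_succ]; rfl
      _ ≤ _ := by
          refine measure_mono fun z hz => ?_
          simp only [Set.mem_pi, Set.mem_univ, true_implies, Fin.forall_fin_succ, Fin.cons_zero,
            Fin.cons_succ, Set.mem_Icc] at hz
          obtain ⟨⟨hz0, hzN⟩, hz1⟩ := hz
          simp only [Set.mem_ofPred_eq, Fin.sum_univ_succ]
          intro i
          have hs1 : ∑ j : Fin n, z j.succ ≤ 2 * n := by
            calc ∑ j : Fin n, z j.succ ≤ ∑ _j : Fin n, (2 : ℝ) :=
                  Finset.sum_le_sum fun j _ => (hz1 j).2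
              _ = 2 * n := by simp [mul_comm]
          have hs2 : 1 ≤ ∑ j : Fin n, z j.succ :=
            (hz1 i).1.trans (Finset.single_le_sum (f := fun j : Fin n => z j.succ)
              (fun j _ => by linarith [(hz1 j).1]) (Finset.mem_univ i))
          rw [le_div_iff₀ (by linarith)]
          calc u * (z 0 + ∑ j : Fin n, z j.succ) ≤ u * (N + 2 * n) := by gcongr
            _ ≤ 1 := huN
            _ ≤ _ := (hz1 i).1
  exact (ENNReal.ofReal_le_iff_le_toReal (by finiteness)).1 h4

/-! ### Tails and small balls. -/

theorem IsDirichletProcess.exists_tail_le {Ω : Type*} [MeasurableSpace Ω]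
    {D : Measure (ProbabilityMeasure Ω)} [IsProbabilityMeasure D] {α : ℝ} (hα : 0 < α)
    {G : Measure Ω} [IsProbabilityMeasure G]
    (hD : IsDirichletProcess D (ENNReal.ofReal α • G)) {A : ℝ → Set Ω}
    (hA : ∀ x, MeasurableSet (A x)) {a a' b K : ℝ} (ha' : 0 < a') (haa' : a' < a) (hb : 0 < b)
    (hK : 0 < K) (hG : ∀ x, 1 ≤ x → G.real (A x) ≤ K * Real.exp (-(a * x ^ b))) :
    ∃ C : ℝ, 0 < C ∧ ∃ x₀ : ℝ, 0 < x₀ ∧ ∀ x : ℝ, x₀ ≤ x →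
      D.real {P | Real.exp (-(a * x ^ b / 2)) ≤ (P : Measure Ω).real (A x)} ≤
        C * Real.exp (-(a' * x ^ b)) := by
  have ha : 0 < a := ha'.trans haa'
  -- The bound on the moment costs `s * a / 2` in the exponent, so `s * a ≤ a - a'` leaves room to
  -- spare.
  obtain ⟨s, hs, hsα, hsa⟩ : ∃ s, 0 < s ∧ s < α / 2 ∧ s * a ≤ a - a' := by
    refine ⟨min (α / 4) ((a - a') / a), lt_min (by linarith) (div_pos (by linarith) ha),
      (min_le_left _ _).trans_lt (by linarith), ?_⟩
    calc _ ≤ (a - a') / a * a := by gcongr; exact min_le_right _ _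
      _ = a - a' := div_mul_cancel₀ _ ha.ne'
  obtain ⟨C, hC, h⟩ := hD.exists_measureReal_le hα hs hsα
  have hlim : Filter.Tendsto (fun x : ℝ => K * Real.exp (-(a * x ^ b))) Filter.atTop (nhds 0) := by
    have := (Real.tendsto_exp_neg_atTop_nhds_zero.comp
      ((tendsto_rpow_atTop hb).const_mul_atTop ha)).const_mul K
    simpa [Function.comp_def] using this
  obtain ⟨x₁, hx₁⟩ := Filter.eventually_atTop.1 (hlim.eventually_le_const one_half_pos)
  refine ⟨C * K, by positivity, max x₁ 1, by positivity, fun x hx => ?_⟩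
  have hx1 : 1 ≤ x := (le_max_right _ _).trans hx
  have hxb : 0 < x ^ b := Real.rpow_pos_of_pos (by linarith) b
  refine (h (A x) (hA x) ((hG x hx1).trans (hx₁ x ((le_max_left _ _).trans hx))) _
    (Real.exp_pos _)).trans ?_
  rw [← Real.exp_mul]
  calc C * (G.real (A x) * Real.exp (-(a * x ^ b / 2) * -s))
      ≤ C * (K * Real.exp (-(a * x ^ b)) * Real.exp (-(a * x ^ b / 2) * -s)) := by
        gcongr; exact hG x hx1
    _ = C * K * Real.exp (-((a - s * a / 2) * x ^ b)) := by
        rw [mul_assoc K, ← Real.exp_add]; ring_nf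
    _ ≤ C * K * Real.exp (-(a' * x ^ b)) := by
        gcongr
        nlinarith [mul_pos hs ha]

theorem mul_succ_le_four_mul_two_pow (J : ℕ) : J * (J + 1) ≤ 4 * 2 ^ J := by
  induction J with
  | zero => simp
  | succ n ih =>
    have h : n + 1 ≤ 2 ^ n := Nat.lt_two_pow_self
    rcases le_or_gt n 1 with h1 | h1
    · interval_cases n <;> norm_num
    · rw [pow_succ]
      nlinarith

theorem IsDirichletProcess.exists_hybridSmallBall {D : Measure (ProbabilityMeasure Scale)}
    [IsProbabilityMeasure D] {α : ℝ} (hα : 0 < α) {G : Measure Scale} [IsProbabilityMeasure G]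
    (hD : IsDirichletProcess D (ENNReal.ofReal α • G)) {a b b' r : ℝ} (ha : 0 < a) (hb : 0 < b)
    (hb' : 0 < b') (hr : 0 < r) (hG : ScaleSmallBall G a b b') :
    ∃ a' : ℝ, 0 < a' ∧ HybridSmallBall D r a' 0 := by
  obtain ⟨c, N, hc, hN, h⟩ := hD.exists_le_measureReal hα
  obtain ⟨c₀, hc₀, h₀⟩ := hG
  -- `K * J` covers both the constant `c * c₀` (since `J ≥ 1`) and `t ^ b' = exp(-log 2 * r * b' *
  -- J)`.
  set K : ℝ := |Real.log (c * c₀)| + Real.log 2 * r * b' with hKdef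
  have hK : 0 < K := by positivity
  have hlim : Filter.Tendsto (fun J : ℕ => (N + 2) * (1 / 2 : ℝ) ^ J +
      2 * ((J : ℝ) ^ 1 / (2 : ℝ) ^ J)) Filter.atTop (nhds 0) := by
    have h1 := (tendsto_pow_atTop_nhds_zero_of_lt_one (r := (1 / 2 : ℝ)) (by norm_num)
      (by norm_num)).const_mul (N + 2)
    have h2 := (tendsto_pow_const_div_const_pow_of_one_lt 1 (one_lt_two (α := ℝ))).const_mul 2
    simpa using h1.add h2
  obtain ⟨J₁, hJ₁⟩ := Filter.eventually_atTop.1 (hlim.eventually_le_const one_pos)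
  -- `2 * a` comes from `∑ 2 ^ j ≤ 2 * 2 ^ J`, and `4 * K` from the `J + 1` factors `exp(-K * J)`
  -- with `J * (J + 1) ≤ 4 * 2 ^ J`.
  refine ⟨2 * a + 4 * K, by positivity, 1 / 2, by norm_num, max J₁ 1, fun J hJ => ?_⟩
  have hJ1 : 1 ≤ J := (le_max_right _ _).trans hJ
  have hJ1' : (1 : ℝ) ≤ J := by exact_mod_cast hJ1
  set t : ℝ := (2 : ℝ) ^ (-((J : ℝ) * r)) with ht
  have ht0 : 0 < t := by positivity
  have ht1 : t < 1 := Real.rpow_lt_one_of_one_lt_of_neg one_lt_two (by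
    have : 0 < (J : ℝ) * r := by positivity
    linarith)
  set I : Fin (J + 1) → Set Scale := fun j =>
    {σ : Scale | ((2 : ℝ) ^ (j : ℕ))⁻¹ ≤ (σ : ℝ) ∧ (σ : ℝ) ≤ ((2 : ℝ) ^ (j : ℕ))⁻¹ * (1 + t)}
    with hI
  have hImeas (j) : MeasurableSet (I j) :=
    (measurableSet_le measurable_const measurable_subtype_coe).inter
      (measurableSet_le measurable_subtype_coe measurable_const)
  -- Since `t < 1`, the interval starting at `2 ^ (-j)` ends strictly before `2 ^ (1 - j)`.
  have hlt (i j : Fin (J + 1)) (hij : i < j) : Disjoint (I i) (I j) := by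
    refine Set.disjoint_left.2 fun σ hi hj => ?_
    have h1 : ((2 : ℝ) ^ (j : ℕ))⁻¹ ≤ ((2 : ℝ) ^ ((i : ℕ) + 1))⁻¹ :=
      inv_anti₀ (by positivity) (pow_le_pow_right₀ one_le_two hij)
    have h2 : ((2 : ℝ) ^ (j : ℕ))⁻¹ * (1 + t) < ((2 : ℝ) ^ (i : ℕ))⁻¹ := by
      calc ((2 : ℝ) ^ (j : ℕ))⁻¹ * (1 + t) < ((2 : ℝ) ^ (j : ℕ))⁻¹ * 2 := by gcongr; linarith
        _ ≤ ((2 : ℝ) ^ ((i : ℕ) + 1))⁻¹ * 2 := by gcongr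
        _ = ((2 : ℝ) ^ (i : ℕ))⁻¹ := by rw [pow_succ]; field_simp
    linarith [hi.1, hj.2]
  have hu : ((2 : ℝ) ^ J)⁻¹ * (N + 2 * (J + 1 : ℕ)) ≤ 1 := by
    refine le_trans (le_of_eq ?_) (hJ₁ J ((le_max_left _ _).trans hJ))
    push_cast
    rw [one_div, inv_pow]
    ring
  have hmain := h (J + 1) I hImeas
    (fun i j hij => (lt_or_gt_of_ne hij).elim (hlt i j) fun h => (hlt j i h).symm)
    ((2 : ℝ) ^ J)⁻¹ (by positivity) hu
  have hset : (⋂ j ∈ Finset.range (J + 1), {P : ProbabilityMeasure Scale |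
        ((2 : ℝ) ^ J)⁻¹ ≤ (P : Measure Scale).real
          {σ : Scale | ((2 : ℝ) ^ j)⁻¹ ≤ (σ : ℝ) ∧ (σ : ℝ) ≤ ((2 : ℝ) ^ j)⁻¹ * (1 + t)}}) =
      {P : ProbabilityMeasure Scale | ∀ i, ((2 : ℝ) ^ J)⁻¹ ≤
        (P : Measure Scale).real (I i)} := by
    ext P
    simp [I, Fin.forall_iff]
  rw [hset]
  refine le_trans ?_ hmain
  gcongr
  have hfac (j : Fin (J + 1)) : Real.exp (-(K * J) - a * 2 ^ (j : ℕ)) ≤ c * G.real (I j) := by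
    have h1 := h₀ ((2 : ℝ) ^ (j : ℕ)) (one_le_pow₀ one_le_two) t ht0 ht1
    have h2 : Real.exp (-(K * J)) ≤ c * c₀ * t ^ b' := by
      rw [ht, ← Real.rpow_mul zero_le_two, Real.rpow_def_of_pos two_pos,
        ← Real.exp_log (mul_pos hc hc₀), ← Real.exp_add, Real.exp_le_exp]
      have h3 := neg_abs_le (Real.log (c * c₀))
      have h4 : |Real.log (c * c₀)| ≤ |Real.log (c * c₀)| * J :=
        le_mul_of_one_le_right (abs_nonneg _) hJ1'
      rw [hKdef]
      linarith
    have h5 : (1 : ℝ) ≤ ((2 : ℝ) ^ (j : ℕ)) ^ b :=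
      Real.one_le_rpow (one_le_pow₀ one_le_two) hb.le
    calc Real.exp (-(K * J) - a * 2 ^ (j : ℕ))
        = Real.exp (-(K * J)) * 1 * Real.exp (-(a * 2 ^ (j : ℕ))) := by
          rw [mul_one, ← Real.exp_add]; ring_nf
      _ ≤ c * c₀ * t ^ b' * ((2 : ℝ) ^ (j : ℕ)) ^ b * Real.exp (-(a * 2 ^ (j : ℕ))) := by gcongr
      _ = c * (c₀ * (((2 : ℝ) ^ (j : ℕ)) ^ b * t ^ b' * Real.exp (-(a * 2 ^ (j : ℕ))))) := by ring
      _ ≤ c * G.real (I j) := by gcongr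
  refine le_trans ?_ (Finset.prod_le_prod (fun j _ => (Real.exp_pos _).le) fun j _ => hfac j)
  rw [← Real.exp_sum, Real.exp_le_exp, Real.rpow_zero, Finset.sum_sub_distrib, ← Finset.mul_sum,
    Fin.sum_univ_eq_sum_range (fun j => (2 : ℝ) ^ j), geom_sum_eq (by norm_num)]
  have h6 : (J : ℝ) * (J + 1) ≤ 4 * 2 ^ J := by exact_mod_cast mul_succ_le_four_mul_two_pow J
  have h7 := mul_le_mul_of_nonneg_left h6 hK.le
  simp only [Finset.sum_const, Finset.card_univ, Fintype.card_fin, nsmul_eq_mul, pow_succ]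
  push_cast
  norm_num
  nlinarith

theorem mainTheorem4
    (ασ : ℝ) (hα : 0 < ασ)
    (G : Measure Scale) [IsProbabilityMeasure G]
    (a₁ a₂ a₃ b₁ b₂ b₃ b₄ : ℝ)
    (ha₁ : 0 < a₁) (ha₂ : 0 < a₂) (ha₃ : 0 < a₃)
    (hb₁ : 0 < b₁) (hb₂ : 0 < b₂) (hb₃ : 0 < b₃) (hb₄ : 0 < b₄)
    (hupper : ScaleUpperTail G a₁ b₁)
    (hlower : ScaleLowerTail G a₂ b₂)
    (hball : ScaleSmallBall G a₃ b₃ b₄)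
    (D : Measure (ProbabilityMeasure Scale)) [IsProbabilityMeasure D]
    (hD : IsDirichletProcess D (ENNReal.ofReal ασ • G)) :
    (∀ a₄ : ℝ, 0 < a₄ → a₄ < a₁ → HybridUpperTail D a₁ b₁ a₄) ∧
    (∀ a₅ : ℝ, 0 < a₅ → a₅ < a₂ → HybridLowerTail D a₂ b₂ a₅) ∧
    (∀ r : ℝ, 1 ≤ r → ∃ a₆ : ℝ, 0 < a₆ ∧ HybridSmallBall D r a₆ 0) := by
  refine ⟨fun a₄ h h' => ?_, fun a₅ h h' => ?_, fun r hr =>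
    hD.exists_hybridSmallBall hα ha₃ hb₃ hb₄ (one_pos.trans_le hr) hball⟩
  · obtain ⟨K, hK, hG⟩ := hupper
    exact hD.exists_tail_le hα
      (fun x => measurableSet_lt measurable_const measurable_subtype_coe) h h' hb₁ hK hG
  · obtain ⟨K, hK, hG⟩ := hlower
    exact hD.exists_tail_le hα
      (fun x => measurableSet_lt measurable_subtype_coe measurable_const) h h' hb₂ hK
      fun x hx => (measureReal_mono (s₂ := {σ : Scale | (σ : ℝ) ≤ 1 / x})
        fun σ (hσ : (σ : ℝ) < 1 / x) => le_of_lt hσ).trans (hG x hx)
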